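/- Conventions. All Banach spaces are real. For a compact Hausdorff space $K$ and a Banach space $E$, $\mathcal C(K,E)$ is the Banach space of continuous functions $K\to E$ with the sup-norm, and $\mathcal C(K)=\mathcal C(K,\mathbb R)$. For a topological space $S$ put $S^{(0)}=S$, let $S^{(\alpha+1)}$ be the set of accumulation points of $S^{(\alpha)}$ in the space $S^{(\alpha)}$, and let $S^{(\alpha)}=\bigcap_{\beta<\alpha}S^{(\beta)}$ for limit ordinals $\alpha$. The space $S$ is scattered if $S^{(\alpha)}=\emptyset$ for some ordinal $\alpha$, and the least such $\alpha$ is its height $ht(S)$. Subsets of topological spaces carry the subspace topology. Let $\mathcal H$ be a closed linear subspace of $\mathcal C(K,E)$. (1) $\Omega_{\mathcal H}=\{y\in K:\ g(y)\neq 0\text{ for some } g\in\mathcal H\}$. (2) A set $\mathcal B\subseteq K$ is a boundary for $\mathcal H$ if $\|h\|=\sup_{x\in\mathcal B}\|h(x)\|$ for each $h\in\mathcal H$ (with $\sup\emptyset=0$). (3) $\mathcal A$ is the closed linear span in $\mathcal C(K)$ of the functions $x\mapsto\langle e^*,h(x)\rangle$, where $e^*\in E^*$ and $h\in\mathcal H$;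 $\mathcal A^E$ is the set of all $f\in\mathcal A$ such that the function $x\mapsto f(x)e$ belongs to $\mathcal H$ for each $e\in E$. (4) The Choquet boundary $\operatorname{Ch}_{\mathcal H}K$ is the set of those $x\in K$ for which the functional $f\mapsto f(x)$ on $\mathcal A$ is an extreme point of the closed unit ball of $\mathcal A^*$. (5) A point $x\in K$ is a weak peak point with respect to $\mathcal H$ if for each neighbourhood $U$ of $x$ and each $\varepsilon\in(0,1)$ there is $h\in\mathcal A^E$ with $0\le h\le 1$ on $K$, $h(x)>1-\varepsilon$, and $h<\varepsilon$ on $\operatorname{Ch}_{\mathcal H}K\setminus U$. The set of weak peak points is denoted by $\mathcal W_{\mathcal H}$. Statement. For $i=1,2$, let $K_i$ be a compact Hausdorff space, $E_i$ a Banach space and $\mathcal H_i$ a closed linear subspace of $\mathcal C(K_i,E_i)$. Suppose that $E_2$ contains no isomorphic copy of $c_0$, that $\mathcal B\subseteq K_2$ is a closed boundary for $\mathcal H_2$, and that $\mathcal H_1$ is isomorphic (linearly homeomorphic) to a subspace of $\mathcal H_2$. If $\mathcal B^{(k)}\cap\Omega_{\mathcal H_2}=\emptyset$ for some natural number $k$,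 then $\mathcal W_{\mathcal H_1}$ is scattered and its height $ht(\mathcal W_{\mathcal H_1})$ is finite. -/

import Mathlib

open Set Filter Topology
open scoped ZeroAtInfty

universe u v

/-- The derivatives `S^(α)` of a subset `S` of a topological space, `S` carrying the subspace
topology: `S^(0) = S`, `S^(α+1)` is the set of those points of `S^(α)` which are accumulation
points of `S^(α)`, and `S^(α) = ⋂_{β < α} S^(β)` for a limit ordinal `α`. -/
noncomputable def cbDerivative {X : Type u} [TopologicalSpace X] (S : Set X) (α : Ordinal.{u}) :
    Set X :=
  Ordinal.limitRecOn (motive := fun _ => Set X) α S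
    (fun _ D => {x | x ∈ D ∧ AccPt x (𝓟 D)})
    (fun α _ D => ⋂ (β : Ordinal.{u}) (h : β < α), D β h)

theorem cbDerivative_zero {X : Type u} [TopologicalSpace X] (S : Set X) :
    cbDerivative S 0 = S := by
  simp [cbDerivative]

theorem cbDerivative_add_one {X : Type u} [TopologicalSpace X] (S : Set X) (α : Ordinal.{u}) :
    cbDerivative S (α + 1) =
      {x | x ∈ cbDerivative S α ∧ AccPt x (𝓟 (cbDerivative S α))} := by
  simp [cbDerivative]

theorem cbDerivative_limit {X : Type u} [TopologicalSpace X] (S : Set X) (α : Ordinal.{u})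
    (hα : Order.IsSuccLimit α) :
    cbDerivative S α = ⋂ (β : Ordinal.{u}) (_ : β < α), cbDerivative S β := by
  simp only [cbDerivative]
  rw [Ordinal.limitRecOn_limit _ _ _ _ hα]

/-- `S`, with the subspace topology, is scattered: some derivative of `S` is empty. -/
def IsScatteredSet {X : Type u} [TopologicalSpace X] (S : Set X) : Prop :=
  ∃ α : Ordinal.{u}, cbDerivative S α = ∅

/-- The height of `S`: the least ordinal `α` with `S^(α) = ∅`
(meaningful only if `S` is scattered). -/
noncomputable def scatteredHeight {X : Type u} [TopologicalSpace X] (S : Set X) : Ordinal.{u} :=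
  sInf {α : Ordinal.{u} | cbDerivative S α = ∅}

/-- `S` has finite height: `S` is scattered and its height is a natural number. -/
def HasFiniteHeight {X : Type u} [TopologicalSpace X] (S : Set X) : Prop :=
  IsScatteredSet S ∧ ∃ n : ℕ, scatteredHeight S = n

/-- `X` is isomorphic (linearly homeomorphic) to a subspace of `Y`, i.e. `Y` contains an
isomorphic copy of `X`. -/
def EmbedsIsomorphically (X : Type u) (Y : Type v) [NormedAddCommGroup X] [NormedSpace ℝ X]
    [NormedAddCommGroup Y] [NormedSpace ℝ Y] : Prop :=
  ∃ M : Submodule ℝ Y, Nonempty (X ≃L[ℝ] M)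

/-- `E` contains an isomorphic copy of `c_0`, the Banach space of real null sequences. -/
def ContainsCZero (E : Type u) [NormedAddCommGroup E] [NormedSpace ℝ E] : Prop :=
  EmbedsIsomorphically C₀(ℕ, ℝ) E

/-- The closed unit ball of the dual space of `X`. -/
def dualUnitBall (X : Type u) [NormedAddCommGroup X] [NormedSpace ℝ X] : Set (StrongDual ℝ X) :=
  Metric.closedBall 0 1

section FunctionSpaces

variable {K : Type u} [TopologicalSpace K] {E : Type v} [NormedAddCommGroup E] [NormedSpace ℝ E]

/-- The function `e^*(h) : x ↦ ⟨e^*, h(x)⟩`. -/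
def dualComp (φ : StrongDual ℝ E) (h : C(K, E)) : C(K, ℝ) :=
  ⟨fun x => φ (h x), by fun_prop⟩

/-- The function `f ⊗ e : x ↦ f(x) e`. -/
def tensorVec (f : C(K, ℝ)) (e : E) : C(K, E) :=
  ⟨fun x => f x • e, by fun_prop⟩

/-- The set `Ω_H` of points at which some member of `H` does not vanish. -/
def nonvanishingSet (H : Submodule ℝ C(K, E)) : Set K :=
  {y | ∃ g ∈ H, g y ≠ 0}

variable [CompactSpace K]

/-- `B` is a boundary for `H`: `‖h‖ = sup_{x ∈ B} ‖h(x)‖` for every `h ∈ H`. The supremum is over a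
bounded set of nonnegative reals, the supremum over the empty set being `0`. -/
def IsBoundary (H : Submodule ℝ C(K, E)) (B : Set K) : Prop :=
  ∀ h ∈ H, ‖h‖ = ⨆ x : B, ‖h x‖

/-- The canonical scalar function space `A` of `H`: the closed linear span in `C(K)` of all the
functions `e^*(h)` with `e^* ∈ E^*` and `h ∈ H`. -/
noncomputable def scalarSpace (H : Submodule ℝ C(K, E)) : Submodule ℝ C(K, ℝ) :=
  (Submodule.span ℝ {f | ∃ φ : StrongDual ℝ E, ∃ h ∈ H, f = dualComp φ h}).topologicalClosure

/-- The set `A^E` of those `f ∈ A` for which `f ⊗ e ∈ H` for every `e ∈ E`. -/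
def scalarMultipliers (H : Submodule ℝ C(K, E)) : Set C(K, ℝ) :=
  {f | f ∈ scalarSpace H ∧ ∀ e : E, tensorVec f e ∈ H}

/-- The evaluation functional `h ↦ h(x)` on a subspace `A` of `C(K)`. -/
noncomputable def evalOn (A : Submodule ℝ C(K, ℝ)) (x : K) : StrongDual ℝ A :=
  (ContinuousMap.evalCLM ℝ x).comp A.subtypeL

/-- The Choquet boundary of `H`: the points `x` whose evaluation functional is an extreme point of
the closed unit ball of the dual of the scalar function space of `H`. -/
def choquetBoundary (H : Submodule ℝ C(K, E)) : Set K :=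
  {x | evalOn (scalarSpace H) x ∈ (dualUnitBall (scalarSpace H)).extremePoints ℝ}

/-- The set `W_H` of weak peak points with respect to `H`. -/
def weakPeakPoints (H : Submodule ℝ C(K, E)) : Set K :=
  {x | ∀ U ∈ 𝓝 x, ∀ ε : ℝ, 0 < ε → ε < 1 →
    ∃ h ∈ scalarMultipliers H, (∀ y, 0 ≤ h y ∧ h y ≤ 1) ∧ 1 - ε < h x ∧
      ∀ y ∈ choquetBoundary H \ U, h y < ε}

end FunctionSpaces

/-! Suppose every finite derivative of the weak peak set is nonempty, and let `R` be the embedding,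
bounded by `C` with inverse bounded by `c`. For a unit vector `e` and small `ε`, the proof builds
arbitrarily many multipliers `f` with values in `[0, 1]`, all above `1 - ε` at one common point,
such that at each point of `B` at most `k` of the `R (f ⊗ e)` have norm at least `ε`. With `m` of
them, the sum has norm at least `m(1 - ε)` while its image has norm at most `kC + mε`, since `B` is
a boundary. This is absurd for large `m`.

The multipliers are added one at a time (`exists_list_multipliers`), each costing one derivative of
the weak peak set. The invariant is that on `B^(r)` at most `k - r` of them are large. Points of
`B^(r)`, `r < k`, where this bound is attained form a finite set, so the next multiplier need only
be small on finitely many points.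

Such a multiplier exists (`exists_multiplier_norm_lt`): peak functions at infinitely many points
with disjoint neighbourhoods have uniformly bounded signed sums, because the Choquet boundary is
norming for `A` (Milman). Their images at a fixed point form a weakly unconditionally Cauchy series
in `E₂`, whose terms tend to `0` as `E₂` has no copy of `c_0` (Bessaga–Pełczyński). -/

/-! ### Milman's theorem and norming by extreme points -/

theorem IsCompact.convexJoin {E : Type*} [AddCommGroup E] [Module ℝ E] [TopologicalSpace E]
    [ContinuousAdd E] [ContinuousSMul ℝ E] {s t : Set E} (hs : IsCompact s) (ht : IsCompact t) :
    IsCompact (_root_.convexJoin ℝ s t) := by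
  have h : _root_.convexJoin ℝ s t =
      (fun p : ℝ × E × E => (1 - p.1) • p.2.1 + p.1 • p.2.2) '' (Icc 0 1 ×ˢ s ×ˢ t) := by
    ext x
    simp only [mem_convexJoin, segment_eq_image, mem_image, mem_prod, Prod.exists]
    constructor
    · rintro ⟨a, ha, b, hb, θ, hθ, rfl⟩
      exact ⟨θ, a, b, ⟨hθ, ha, hb⟩, rfl⟩
    · rintro ⟨θ, a, b, ⟨hθ, ha, hb⟩, rfl⟩
      exact ⟨a, ha, b, hb, θ, hθ, rfl⟩
  rw [h]
  exact (isCompact_Icc.prod (hs.prod ht)).image (by fun_prop)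

/-- Join the sets one by one: an extreme point of `s` lying on a segment in `s` is an endpoint, so
joining two sets that miss `x` gives a set that misses `x`. -/
theorem exists_isCompact_convex_of_mem_extremePoints {E : Type*} [AddCommGroup E] [Module ℝ E]
    [TopologicalSpace E] [IsTopologicalAddGroup E] [ContinuousSMul ℝ E] {ι : Type*} {s : Set E} (hsconv : Convex ℝ s)
    {x : E} (hx : x ∈ s.extremePoints ℝ) (C : ι → Set E) (t : Finset ι)
    (hC : ∀ i ∈ t, IsCompact (C i) ∧ Convex ℝ (C i) ∧ C i ⊆ s ∧ x ∉ C i) :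
    ∃ D : Set E, IsCompact D ∧ Convex ℝ D ∧ D ⊆ s ∧ x ∉ D ∧ ∀ i ∈ t, C i ⊆ D := by
  classical
  induction t using Finset.induction_on with
  | empty => exact ⟨∅, isCompact_empty, convex_empty, empty_subset _, by simp, by simp⟩
  | insert i t _ ih =>
    obtain ⟨D, hDc, hDv, hDs, hxD, hD⟩ := ih fun j hj => hC j (Finset.mem_insert_of_mem hj)
    obtain ⟨hic, hiv, his, hxi⟩ := hC i (Finset.mem_insert_self _ _)
    rcases D.eq_empty_or_nonempty with rfl | hDn
    · refine ⟨C i, hic, hiv, his, hxi, fun j hj => ?_⟩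
      rcases Finset.mem_insert.1 hj with rfl | hj
      · exact Subset.rfl
      · exact (hD j hj).trans (empty_subset _)
    rcases (C i).eq_empty_or_nonempty with hi | hin
    · refine ⟨D, hDc, hDv, hDs, hxD, fun j hj => ?_⟩
      rcases Finset.mem_insert.1 hj with rfl | hj
      · exact hi ▸ empty_subset _
      · exact hD j hj
    refine ⟨convexJoin ℝ (C i) D, hic.convexJoin hDc, hiv.convexJoin hDv,
      convexJoin_subset his hDs hsconv, fun hxj => ?_, fun j hj => ?_⟩
    · obtain ⟨a, ha, b, hb, hab⟩ := mem_convexJoin.1 hxj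
      rcases (mem_extremePoints_iff_forall_segment.1 hx).2 a (his ha) b (hDs hb) hab with h | h
      · exact hxi (h ▸ ha)
      · exact hxD (h ▸ hb)
    · rcases Finset.mem_insert.1 hj with rfl | hj
      · exact subset_convexJoin_left hDn
      · exact (hD j hj).trans (subset_convexJoin_right hin)

/-- **Milman's theorem**: if a compact convex set is contained in the closed convex hull of a
compact subset `Q`, then all its extreme points lie in `Q`. -/
theorem IsCompact.extremePoints_subset_of_subset_closure_convexHull {E : Type*} [AddCommGroup E]
    [Module ℝ E] [TopologicalSpace E] [T2Space E] [IsTopologicalAddGroup E] [ContinuousSMul ℝ E]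
    [LocallyConvexSpace ℝ E] {s Q : Set E}
    (hs : IsCompact s) (hsconv : Convex ℝ s) (hQ : IsCompact Q) (hQs : Q ⊆ s)
    (hsQ : s ⊆ closure (convexHull ℝ Q)) : s.extremePoints ℝ ⊆ Q := by
  intro x hx
  by_contra hxQ
  have hsep : ∀ q : E, ∃ l : StrongDual ℝ E, q ∈ Q → l q < l x := fun q => by
    by_cases hq : q ∈ Q
    · obtain ⟨l, hl⟩ := geometric_hahn_banach_point_point (E := E) (x := q) (y := x)
        (fun h => hxQ (h ▸ hq))
      exact ⟨l, fun _ => hl⟩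
    · exact ⟨0, fun h => absurd h hq⟩
  choose l hl using hsep
  -- Cutting halfway between `l q q` and `l q x` leaves `x` outside a closed slice that contains a
  -- neighbourhood of `q` in `s`.
  let C : E → Set E := fun q => s ∩ {z | l q z ≤ (l q q + l q x) / 2}
  obtain ⟨t, htQ, ht⟩ := hQ.elim_nhds_subcover (fun q => {z | l q z < (l q q + l q x) / 2})
    fun q hq => (isOpen_lt (l q).continuous continuous_const).mem_nhds (by
      have := hl q hq
      simp only [mem_ofPred_eq]
      linarith)
  obtain ⟨D, hDc, hDv, -, hxD, hD⟩ := exists_isCompact_convex_of_mem_extremePoints hsconv hx C t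
    fun q hq => ⟨hs.inter_right (isClosed_le (l q).continuous continuous_const),
      hsconv.inter (convex_halfSpace_le (l q).toLinearMap.isLinear _), inter_subset_left,
      fun h => by
        have h1 := h.2
        have := hl q (htQ q hq)
        simp only [mem_ofPred_eq] at h1
        linarith⟩
  have hQD : Q ⊆ D := fun q hq => by
    obtain ⟨i, hi, hqi⟩ := mem_iUnion₂.1 (ht hq)
    exact hD i hi ⟨hQs hq, le_of_lt (show l i q < _ from hqi)⟩
  exact hxD (closure_minimal (convexHull_min hQD hDv) hDc.isClosed (hsQ hx.1))

/-- If a weak-star continuous family `f`, indexed by a compact space, of members of the closed dual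
unit ball is norming, then so are those of its members that are extreme points of the ball. -/
theorem abs_apply_le_of_forall_mem_extremePoints {X : Type*} [NormedAddCommGroup X]
    [NormedSpace ℝ X] {K : Type*} [TopologicalSpace K] [CompactSpace K] {f : K → StrongDual ℝ X}
    (hf : ∀ b, Continuous fun y => f y b) (hf1 : ∀ y, ‖f y‖ ≤ 1)
    (hfn : ∀ b r, 0 ≤ r → (∀ y, |f y b| ≤ r) → ‖b‖ ≤ r) {a : X} {M : ℝ}
    (hM : ∀ y, f y ∈ (dualUnitBall X).extremePoints ℝ → |f y a| ≤ M) (x : K) :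
    |f x a| ≤ M := by
  have : LocallyConvexSpace ℝ (WeakDual ℝ X) :=
    inferInstanceAs (LocallyConvexSpace ℝ (WeakBilin (topDualPairing ℝ X)))
  let s : Set (WeakDual ℝ X) := WeakDual.toStrongDual ⁻¹' Metric.closedBall 0 1
  have hs : IsCompact s := WeakDual.isCompact_closedBall (𝕜 := ℝ) (E := X) 0 1
  have hmem : ∀ φ : WeakDual ℝ X, φ ∈ s ↔ ‖WeakDual.toStrongDual φ‖ ≤ 1 := fun φ => by
    simp [s]
  have hsconv : Convex ℝ s :=
    (convex_closedBall (0 : StrongDual ℝ X) 1).linear_preimage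
      (WeakDual.toStrongDual (𝕜 := ℝ) (E := X)).toLinearMap
  let e : K → WeakDual ℝ X := fun y => StrongDual.toWeakDual (f y)
  have he : Continuous e := WeakBilin.continuous_of_continuous_eval _ hf
  have hes : ∀ y, e y ∈ s := fun y => (hmem _).2 (hf1 y)
  have hneg : ∀ φ ∈ s, -φ ∈ s := fun φ hφ => by
    rw [hmem] at hφ ⊢
    rwa [map_neg, norm_neg]
  let Q : Set (WeakDual ℝ X) := range e ∪ range fun y => -e y
  have hQ : IsCompact Q := (isCompact_range he).union (isCompact_range he.neg)
  have hQs : Q ⊆ s := by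
    rintro _ (⟨y, rfl⟩ | ⟨y, rfl⟩)
    · exact hes y
    · exact hneg _ (hes y)
  have hsQ : s ⊆ closure (convexHull ℝ Q) := by
    intro φ hφ
    by_contra hφQ
    obtain ⟨g, r, hg, hr⟩ := geometric_hahn_banach_closed_point
      (convex_convexHull ℝ Q).closure isClosed_closure hφQ
    -- Weak-star continuous functionals are evaluations, so the separation contradicts the norming
    -- hypothesis at `b`.
    obtain ⟨b, rfl⟩ := LinearMap.dualEmbedding_surjective (topDualPairing ℝ X) g
    have hb : ∀ ψ : WeakDual ℝ X, WeakBilin.eval (topDualPairing ℝ X) b ψ = ψ b := fun _ => rfl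
    have hQr : ∀ ψ ∈ Q, ψ b < r := fun ψ hψ =>
      hb ψ ▸ hg ψ (subset_closure (subset_convexHull ℝ Q hψ))
    have hbr : ∀ y, |f y b| < r := fun y => by
      have h1 := hQr (e y) (Or.inl ⟨y, rfl⟩)
      have h2 := hQr (-e y) (Or.inr ⟨y, rfl⟩)
      exact abs_lt.2 ⟨neg_lt.1 h2, h1⟩
    have hbn : ‖b‖ ≤ r :=
      hfn b r ((abs_nonneg _).trans (hbr x).le) fun y => (hbr y).le
    have h3 : φ b ≤ ‖b‖ := by
      have := (WeakDual.toStrongDual φ).le_of_opNorm_le ((hmem _).1 hφ) b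
      rw [one_mul] at this
      exact (le_abs_self _).trans this
    have hr' : r < φ b := hr
    linarith
  have hMil := hs.extremePoints_subset_of_subset_closure_convexHull hsconv hQ hQs hsQ
  let l : StrongDual ℝ (WeakDual ℝ X) := WeakBilin.eval (topDualPairing ℝ X) a
  -- An extreme point of the face where evaluation at `a` is maximal is extreme in the ball, hence
  -- some `± e y` by Milman.
  have hexp : IsExposed ℝ s {φ ∈ s | ∀ ψ ∈ s, l ψ ≤ l φ} := fun _ => ⟨l, rfl⟩
  obtain ⟨φ₀, hφ₀, hmax⟩ := hs.exists_isMaxOn ⟨e x, hes x⟩ l.continuous.continuousOn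
  obtain ⟨φ, hφ⟩ := (hexp.isCompact hs).extremePoints_nonempty ⟨φ₀, hφ₀, hmax⟩
  have hφs : φ ∈ s.extremePoints ℝ := hexp.isExtreme.extremePoints_subset_extremePoints hφ
  have hφm : |f x a| ≤ l φ := abs_le'.2 ⟨hφ.1.2 _ (hes x), hφ.1.2 _ (hneg _ (hes x))⟩
  have hext : ∀ y, e y ∈ s.extremePoints ℝ →
      f y ∈ (dualUnitBall X).extremePoints ℝ := fun y hy => hy
  rcases hMil hφs with ⟨y, rfl⟩ | ⟨y, rfl⟩
  · exact (hφm.trans (le_abs_self (f y a))).trans (hM y (hext y hφs))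
  · refine (hφm.trans (neg_le_abs (f y a))).trans (hM y (hext y ?_))
    refine ⟨hes y, fun ψ₁ h₁ ψ₂ h₂ h => ?_⟩
    have := hφs.2 (hneg _ h₁) (hneg _ h₂) (by
      obtain ⟨α, β, hα, hβ, hαβ, h⟩ := h
      exact ⟨α, β, hα, hβ, hαβ, by
        change α • -ψ₁ + β • -ψ₂ = -e y
        rw [smul_neg, smul_neg, ← neg_add, h]⟩)
    exact neg_injective this

/-- The points whose evaluation functional is an extreme point of the dual unit ball form a
boundary for a space of continuous functions. -/
theorem abs_apply_le_of_forall_evalOn_mem_extremePoints {K : Type u} [TopologicalSpace K]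
    [CompactSpace K] (A : Submodule ℝ C(K, ℝ)) {a : C(K, ℝ)} (ha : a ∈ A) {M : ℝ}
    (hM : ∀ x, evalOn A x ∈ (dualUnitBall A).extremePoints ℝ → |a x| ≤ M) (x : K) :
    |a x| ≤ M := by
  refine abs_apply_le_of_forall_mem_extremePoints (X := A) (f := evalOn A) (a := ⟨a, ha⟩)
    (fun b => (b : C(K, ℝ)).continuous) (fun y => ?_) (fun b r hr hb => ?_) (fun y hy => ?_) x
  · refine ContinuousLinearMap.opNorm_le_bound _ zero_le_one fun b => ?_
    rw [one_mul]
    exact (b : C(K, ℝ)).norm_coe_le_norm y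
  · exact (ContinuousMap.norm_le _ hr).2 hb
  · have h1 := hM y (by with_reducible_and_instances exact hy)
    exact h1

/-! ### Rosenthal's lemma and copies of `c_0` -/

/-- **Rosenthal's lemma**, in a version for nonnegative matrices with uniformly bounded row sums. -/
theorem exists_injective_forall_sum_le_of_forall_sum_le {δ : ℝ} (j : ℕ) (a : ℕ → ℕ → ℝ)
    (hj : ∀ n, ∀ F : Finset ℕ, ∑ m ∈ F, a n m ≤ j * δ) (hδ : 0 ≤ δ) :
    ∃ g : ℕ → ℕ, Function.Injective g ∧
      ∀ n, ∀ F : Finset ℕ, n ∉ F → ∑ m ∈ F, a (g n) (g m) ≤ δ := by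
  induction j generalizing a with
  | zero => exact ⟨id, Function.injective_id, fun n F _ => (hj n F).trans (by simpa using hδ)⟩
  | succ j ih =>
    by_cases hp : ∃ p, ∀ n, ∀ F : Finset ℕ, n ∉ F →
        ∑ m ∈ F, a (Nat.pair p n) (Nat.pair p m) ≤ δ
    · obtain ⟨p, hp⟩ := hp
      exact ⟨Nat.pair p, fun m n h => (Nat.pair_eq_pair.1 h).2, hp⟩
    -- `Nat.pair` splits the indices into infinitely many blocks. If every block fails, each has an
    -- index `q p` whose row has mass above `δ` inside the block, off the diagonal. Keeping only
    -- these indices lowers the row bound by `δ`.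
    push Not at hp
    choose q F hqF hF using hp
    have hinj : Function.Injective fun p => Nat.pair p (q p) :=
      fun m n h => (Nat.pair_eq_pair.1 h).1
    obtain ⟨g, hg, hgs⟩ := ih (fun p p' => a (Nat.pair p (q p)) (Nat.pair p' (q p')))
      fun p G => by
        have hinj' : Function.Injective (Nat.pair p) := fun m n h => (Nat.pair_eq_pair.1 h).2
        have hdisj : Disjoint (G.map ⟨_, hinj⟩) ((F p).map ⟨_, hinj'⟩) := by
          rw [Finset.disjoint_left]
          intro x hx hx'
          obtain ⟨r, -, rfl⟩ := Finset.mem_map.1 hx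
          obtain ⟨m, hm, h⟩ := Finset.mem_map.1 hx'
          obtain ⟨rfl, rfl⟩ := Nat.pair_eq_pair.1 h
          exact hqF _ hm
        have h := hj (Nat.pair p (q p)) ((G.map ⟨_, hinj⟩).disjUnion ((F p).map ⟨_, hinj'⟩) hdisj)
        rw [Finset.sum_disjUnion, Finset.sum_map, Finset.sum_map] at h
        have h' := hF p
        simp only [Function.Embedding.coeFn_mk] at h
        push_cast at h
        linarith
    exact ⟨_, hinj.comp hg, hgs⟩

section CZero

variable {E : Type v} [NormedAddCommGroup E] [NormedSpace ℝ E]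

/-- The finite sums `∑ c i • v i` with coefficients `|c i| ≤ 1` are bounded by `M`, i.e. the series
`∑ v i` is weakly unconditionally Cauchy. -/
def UnconditionallyBounded (v : ℕ → E) (M : ℝ) : Prop :=
  ∀ (F : Finset ℕ) (c : ℕ → ℝ), (∀ i, |c i| ≤ 1) → ‖∑ i ∈ F, c i • v i‖ ≤ M

namespace UnconditionallyBounded

variable {v : ℕ → E} {M : ℝ}

theorem nonneg (hv : UnconditionallyBounded v M) : 0 ≤ M := by
  simpa using hv ∅ 0 (by simp)

theorem comp (hv : UnconditionallyBounded v M) {g : ℕ → ℕ} (hg : Function.Injective g) :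
    UnconditionallyBounded (v ∘ g) M := by
  intro F c hc
  have h := hv (F.map ⟨g, hg⟩) (fun i => c (Function.invFun g i)) fun i => hc _
  rw [Finset.sum_map] at h
  simpa [Function.leftInverse_invFun hg _] using h

theorem norm_sum_le (hv : UnconditionallyBounded v M) (F : Finset ℕ) (c : ℕ → ℝ) {r : ℝ}
    (hr : 0 ≤ r) (hc : ∀ i ∈ F, |c i| ≤ r) : ‖∑ i ∈ F, c i • v i‖ ≤ r * M := by
  classical
  rcases hr.eq_or_lt with rfl | hr
  · rw [Finset.sum_eq_zero fun i hi => by rw [abs_nonpos_iff.1 (hc i hi), zero_smul]]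
    simp
  have h := hv F (fun i => if i ∈ F then r⁻¹ * c i else 0) fun i => by
    split_ifs with hi
    · rw [abs_mul, abs_inv, abs_of_pos hr, inv_mul_le_one₀ hr]
      exact hc i hi
    · simp
  have h' : ∑ i ∈ F, c i • v i = r • ∑ i ∈ F, (if i ∈ F then r⁻¹ * c i else 0) • v i := by
    rw [Finset.smul_sum]
    refine Finset.sum_congr rfl fun i hi => ?_
    rw [if_pos hi, smul_smul, mul_inv_cancel_left₀ hr.ne']
  rw [h', norm_smul, Real.norm_of_nonneg hr.le]
  exact mul_le_mul_of_nonneg_left h hr.le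

theorem sum_abs_le (hv : UnconditionallyBounded v M) {φ : StrongDual ℝ E} (hφ : ‖φ‖ ≤ 1)
    (F : Finset ℕ) : ∑ i ∈ F, |φ (v i)| ≤ M := by
  have h := hv F (fun i => SignType.sign (φ (v i))) fun i => by
    rcases lt_trichotomy (φ (v i)) 0 with h | h | h <;> simp [h]
  have h' : ∑ i ∈ F, |φ (v i)| = φ (∑ i ∈ F, (SignType.sign (φ (v i)) : ℝ) • v i) := by
    simp [sign_mul_self]
  rw [h']
  calc _ ≤ ‖φ (∑ i ∈ F, (SignType.sign (φ (v i)) : ℝ) • v i)‖ := le_abs_self _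
    _ ≤ 1 * M := φ.le_of_opNorm_le_of_le hφ h
    _ = M := one_mul M

theorem summable [CompleteSpace E] (hv : UnconditionallyBounded v M) (c : C₀(ℕ, ℝ)) :
    Summable fun i => c i • v i := by
  rw [summable_iff_vanishing_norm]
  intro ε hε
  have hM := hv.nonneg
  have hfin : {i : ℕ | ¬ |c i| ≤ ε / (2 * (M + 1))}.Finite := by
    have h := c.zero_at_infty'
    rw [cocompact_eq_cofinite] at h
    have := h.eventually (Metric.closedBall_mem_nhds (0 : ℝ)
      (show 0 < ε / (2 * (M + 1)) by positivity))
    simpa [Filter.eventually_cofinite] using this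
  refine ⟨hfin.toFinset, fun F hF => ?_⟩
  refine (hv.norm_sum_le F c (r := ε / (2 * (M + 1))) (by positivity) fun i hi => ?_).trans_lt ?_
  · by_contra hi'
    exact Finset.disjoint_left.1 hF hi (hfin.mem_toFinset.2 hi')
  · rw [div_mul_eq_mul_div, div_lt_iff₀ (by positivity)]
    nlinarith

end UnconditionallyBounded

theorem C0.abs_apply_le_norm (c : C₀(ℕ, ℝ)) (i : ℕ) : |c i| ≤ ‖c‖ :=
  c.toBCF.norm_coe_le_norm i

/-- **Bessaga–Pełczyński**: a weakly unconditionally Cauchy series with terms bounded away from `0`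
yields an isomorphic copy of `c_0`. -/
theorem UnconditionallyBounded.containsCZero [CompleteSpace E] {v : ℕ → E} {M : ℝ}
    (hv : UnconditionallyBounded v M) {δ : ℝ} (hδ : 0 < δ) (hvδ : ∀ i, δ ≤ ‖v i‖) :
    ContainsCZero E := by
  have hφ : ∀ i, ∃ φ : StrongDual ℝ E, ‖φ‖ ≤ 1 ∧ φ (v i) = ‖v i‖ :=
    fun i => exists_dual_vector'' ℝ (v i)
  choose φ hφ1 hφv using hφ
  obtain ⟨j, hj⟩ := exists_nat_ge (M / (δ / 2))
  obtain ⟨g, hg, hgs⟩ := exists_injective_forall_sum_le_of_forall_sum_le (δ := δ / 2) j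
    (fun n m => |φ n (v m)|)
    (fun n F => (hv.sum_abs_le (hφ1 n) F).trans ((div_le_iff₀ (by positivity)).1 hj))
    (by positivity)
  have hw := hv.comp hg
  have hsum := hw.summable
  let T : C₀(ℕ, ℝ) →ₗ[ℝ] E :=
    { toFun := fun c => ∑' i, c i • (v ∘ g) i
      map_add' := fun c d => by
        rw [← (hsum c).tsum_add (hsum d)]
        simp [add_smul]
      map_smul' := fun r c => by
        simp only [RingHom.id_apply]
        rw [← (hsum c).tsum_const_smul]
        simp [mul_smul] }
  have hlim : ∀ c, Tendsto (fun F : Finset ℕ => ‖∑ i ∈ F, c i • (v ∘ g) i‖) atTop (𝓝 ‖T c‖) :=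
    fun c => (hsum c).hasSum.norm
  have hup : ∀ c, ‖T c‖ ≤ M * ‖c‖ := fun c => le_of_tendsto' (hlim c) fun F => by
    rw [mul_comm]
    exact hw.norm_sum_le F c (norm_nonneg c) fun i _ => C0.abs_apply_le_norm c i
  -- Apply `φ (g n)`: the diagonal term is at least `|c n| δ`, and Rosenthal's lemma bounds the rest
  -- by `‖c‖ δ / 2`, which can be absorbed.
  have hlow : ∀ c n, |c n| * δ ≤ ‖T c‖ + δ / 2 * ‖c‖ := fun c n => by
    refine ge_of_tendsto ((hlim c).add_const _) ?_
    filter_upwards [eventually_ge_atTop {n}] with F hF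
    have hn : n ∈ F := hF (Finset.mem_singleton_self n)
    have h1 : ‖φ (g n) (∑ i ∈ F, c i • (v ∘ g) i)‖ ≤ 1 * ‖∑ i ∈ F, c i • (v ∘ g) i‖ :=
      (φ (g n)).le_of_opNorm_le (hφ1 _) _
    have h2 : φ (g n) (∑ i ∈ F, c i • (v ∘ g) i) =
        c n * ‖v (g n)‖ + ∑ i ∈ F.erase n, c i * φ (g n) (v (g i)) := by
      rw [map_sum, ← Finset.add_sum_erase F _ hn]
      simp [hφv]
    have h3 : |∑ i ∈ F.erase n, c i * φ (g n) (v (g i))| ≤ ‖c‖ * (δ / 2) := by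
      refine (Finset.abs_sum_le_sum_abs _ _).trans ?_
      refine le_trans ?_ (mul_le_mul_of_nonneg_left
        (hgs n (F.erase n) (Finset.notMem_erase n F)) (norm_nonneg c))
      rw [Finset.mul_sum]
      refine Finset.sum_le_sum fun i _ => ?_
      rw [abs_mul]
      exact mul_le_mul_of_nonneg_right (C0.abs_apply_le_norm c i) (abs_nonneg _)
    have h4 : |c n| * δ ≤ |c n * ‖v (g n)‖| := by
      rw [abs_mul, abs_norm]
      exact mul_le_mul_of_nonneg_left (hvδ _) (abs_nonneg _)
    have h5 := abs_sub_abs_le_abs_sub (c n * ‖v (g n)‖)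
      (-∑ i ∈ F.erase n, c i * φ (g n) (v (g i)))
    rw [sub_neg_eq_add, ← h2, abs_neg] at h5
    rw [Real.norm_eq_abs] at h1
    linarith
  have hlow' : ∀ c, ‖c‖ ≤ 2 / δ * ‖T c‖ := fun c => by
    have h : ‖c‖ ≤ (‖T c‖ + δ / 2 * ‖c‖) / δ :=
      (BoundedContinuousFunction.norm_le (f := c.toBCF) (by positivity)).2 fun n =>
        (le_div_iff₀ hδ).2 (hlow c n)
    rw [le_div_iff₀ hδ] at h
    rw [div_mul_eq_mul_div, le_div_iff₀ hδ]
    linarith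
  have hinj : Function.Injective T := (injective_iff_map_eq_zero T).2 fun c hc => by
    have := hlow' c
    rw [hc, norm_zero, mul_zero] at this
    exact norm_le_zero_iff.1 this
  refine ⟨LinearMap.range T, ⟨(LinearEquiv.ofInjective T hinj).toContinuousLinearEquivOfBounds
    M (2 / δ) hup fun y => ?_⟩⟩
  obtain ⟨c, rfl⟩ := (LinearEquiv.ofInjective T hinj).surjective y
  rw [LinearEquiv.symm_apply_apply]
  exact hlow' c

theorem UnconditionallyBounded.finite_setOf_le_norm [CompleteSpace E] (hE : ¬ ContainsCZero E)
    {v : ℕ → E} {M : ℝ} (hv : UnconditionallyBounded v M) {ε : ℝ} (hε : 0 < ε) :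
    {i | ε ≤ ‖v i‖}.Finite := by
  by_contra h
  have hinf : {i | ε ≤ ‖v i‖}.Infinite := h
  exact hE ((hv.comp (g := fun n => (hinf.natEmbedding _ n : ℕ))
    (Subtype.val_injective.comp (hinf.natEmbedding _).injective)).containsCZero hε
    fun n => (hinf.natEmbedding _ n).2)

end CZero

/-! ### Finite derivatives and accumulation points -/

section Derivatives

variable {X : Type u} [TopologicalSpace X]

theorem cbDerivative_natCast_succ (S : Set X) (n : ℕ) :
    cbDerivative S ((n + 1 : ℕ) : Ordinal.{u}) =
      {x | x ∈ cbDerivative S n ∧ AccPt x (𝓟 (cbDerivative S n))} := by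
  rw [Nat.cast_succ, cbDerivative_add_one]

theorem cbDerivative_natCast_subset (S : Set X) (n : ℕ) : cbDerivative S (n : Ordinal.{u}) ⊆ S := by
  induction n with
  | zero => rw [Nat.cast_zero, cbDerivative_zero]
  | succ n ih =>
    rw [cbDerivative_natCast_succ]
    exact fun x hx => ih hx.1

theorem IsClosed.mem_of_accPt {S : Set X} (hS : IsClosed S) {x : X} (hx : AccPt x (𝓟 S)) :
    x ∈ S :=
  isClosed_iff_clusterPt.1 hS x hx.clusterPt

theorem IsClosed.cbDerivative_natCast [T1Space X] {S : Set X} (hS : IsClosed S) (n : ℕ) :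
    IsClosed (cbDerivative S (n : Ordinal.{u})) := by
  induction n with
  | zero => rwa [Nat.cast_zero, cbDerivative_zero]
  | succ n ih =>
    rw [cbDerivative_natCast_succ]
    exact ih.inter (isClosed_derivedSet _)

theorem hasFiniteHeight_of_cbDerivative_natCast_eq_empty {S : Set X} {n : ℕ}
    (h : cbDerivative S (n : Ordinal.{u}) = ∅) : HasFiniteHeight S := by
  refine ⟨⟨n, h⟩, Ordinal.lt_omega0.1 (lt_of_le_of_lt (csInf_le' ?_) (Ordinal.natCast_lt_omega0 n))⟩
  exact h

/-- An accumulation point `z` of an infinite such set would lie in the next derivative, where `N z +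
j < k`; upper semicontinuity carries this strict bound to nearby points of the set. -/
theorem finite_setOf_mem_cbDerivative_le [T1Space X] [CompactSpace X] {B : Set X}
    (hB : IsClosed B) {N : X → ℕ} (hN : ∀ z, ∀ᶠ y in 𝓝 z, N y ≤ N z) {k j : ℕ}
    (hk : ∀ y ∈ cbDerivative B ((j + 1 : ℕ) : Ordinal.{u}), N y + (j + 1) ≤ k) :
    {y | y ∈ cbDerivative B (j : Ordinal.{u}) ∧ k ≤ N y + j}.Finite := by
  by_contra hinf
  obtain ⟨z, -, hz⟩ := Set.Infinite.exists_accPt_of_subset_isCompact hinf isCompact_univ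
    (subset_univ _)
  have hz' : AccPt z (𝓟 (cbDerivative B (j : Ordinal.{u}))) :=
    hz.mono (principal_mono.2 fun y hy => hy.1)
  have hzj := hk z (by
    rw [cbDerivative_natCast_succ]
    exact ⟨(hB.cbDerivative_natCast j).mem_of_accPt hz', hz'⟩)
  obtain ⟨y, ⟨-, -, hy⟩, hyz⟩ := ((accPt_iff_frequently.1 hz).and_eventually (hN z)).exists
  omega

/-- The complement of each chosen neighbourhood stays a neighbourhood of `x`, so there is always
room for another point of `S` near `x`. -/
theorem AccPt.exists_seq_pairwise_disjoint_nhds [T2Space X] {S U : Set X} {x : X}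
    (hx : AccPt x (𝓟 S)) (hU : U ∈ 𝓝 x) :
    ∃ (p : ℕ → X) (V : ℕ → Set X), (∀ n, p n ∈ S ∩ U) ∧ (∀ n, V n ∈ 𝓝 (p n)) ∧
      Pairwise (Function.onFun Disjoint V) := by
  obtain ⟨f, hf, hd⟩ := exists_seq_of_forall_finset_exists'
    (fun a : X × Set X => a.1 ∈ S ∩ U ∧ a.2 ∈ 𝓝 a.1 ∧ a.2ᶜ ∈ 𝓝 x)
    (fun a b => Disjoint a.2 b.2) (by
      intro s hs
      have hW : U ∩ ⋂ a ∈ s, a.2ᶜ ∈ 𝓝 x :=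
        inter_mem hU ((biInter_finset_mem s).2 fun a ha => (hs a ha).2.2)
      obtain ⟨O, hOW, hO, hxO⟩ := mem_nhds_iff.1 hW
      obtain ⟨q, ⟨hqO, hqS⟩, hqx⟩ := accPt_iff_nhds.1 hx O (hO.mem_nhds hxO)
      obtain ⟨G, G', hG, hG', hqG, hxG', hGG'⟩ := t2_separation hqx
      refine ⟨(q, G ∩ O), ⟨⟨hqS, (hOW hqO).1⟩, inter_mem (hG.mem_nhds hqG) (hO.mem_nhds hqO),
        mem_of_superset (hG'.mem_nhds hxG') fun y hy hy' =>
          disjoint_left.1 hGG' hy'.1 hy⟩, fun a ha => ?_⟩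
      rw [disjoint_left]
      intro y hya hy
      exact mem_iInter₂.1 (hOW hy.2).2 a ha hya)
  · exact ⟨fun n => (f n).1, fun n => (f n).2, fun n => (hf n).1, fun n => (hf n).2.1, hd⟩

end Derivatives

/-! ### Multipliers and their signed sums -/

section Multipliers

variable {K₁ : Type u} [TopologicalSpace K₁] [CompactSpace K₁]
  {E₁ : Type*} [NormedAddCommGroup E₁] [NormedSpace ℝ E₁] {H₁ : Submodule ℝ C(K₁, E₁)}

/-- The function `f ⊗ e` as a member of `H`. -/
def multiplierTensor (f : scalarMultipliers H₁) (e : E₁) : H₁ :=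
  ⟨tensorVec f e, f.2.2 e⟩

theorem coe_multiplierTensor_apply (f : scalarMultipliers H₁) (e : E₁) (x : K₁) :
    (multiplierTensor f e : C(K₁, E₁)) x = (f : C(K₁, ℝ)) x • e := rfl

theorem norm_multiplierTensor_le {f : scalarMultipliers H₁}
    (hf : ∀ y, 0 ≤ (f : C(K₁, ℝ)) y ∧ (f : C(K₁, ℝ)) y ≤ 1) (e : E₁) : ‖multiplierTensor f e‖ ≤ ‖e‖ := by
  refine (ContinuousMap.norm_le _ (norm_nonneg e)).2 fun y => ?_
  change ‖(multiplierTensor f e : C(K₁, E₁)) y‖ ≤ ‖e‖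
  rw [coe_multiplierTensor_apply, norm_smul, Real.norm_of_nonneg (hf y).1]
  exact mul_le_of_le_one_left (norm_nonneg e) (hf y).2

/-- At most one `V i` contains `y`, contributing at most `1`; the other terms are dominated by a
geometric series of sum `1`. -/
theorem sum_le_two_of_pairwise_disjoint {X : Type*} {V : ℕ → Set X}
    (hV : Pairwise (Function.onFun Disjoint V)) {t : ℕ → ℝ} {y : X} (ht1 : ∀ i, t i ≤ 1)
    (ht : ∀ i, y ∉ V i → t i ≤ (1 / 2) ^ i / 2) (F : Finset ℕ) : ∑ i ∈ F, t i ≤ 2 := by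
  classical
  have h1 : ∑ i ∈ F, t i ≤ ∑ i ∈ F, ((if y ∈ V i then (1 : ℝ) else 0) + (1 / 2) ^ i / 2) := by
    refine Finset.sum_le_sum fun i _ => ?_
    split_ifs with hi
    · have : (0 : ℝ) ≤ (1 / 2) ^ i / 2 := by positivity
      linarith [ht1 i]
    · rw [zero_add]
      exact ht i hi
  have h2 : ∑ i ∈ F, (if y ∈ V i then (1 : ℝ) else 0) ≤ 1 := by
    rw [Finset.sum_boole]
    have : (F.filter fun i => y ∈ V i).card ≤ 1 := Finset.card_le_one.2 fun i hi j hj => by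
      by_contra hij
      exact disjoint_left.1 (hV hij) (Finset.mem_filter.1 hi).2 (Finset.mem_filter.1 hj).2
    exact_mod_cast this
  have h3 : ∑ i ∈ F, ((1 : ℝ) / 2) ^ i / 2 ≤ 1 := by
    rw [← Finset.sum_div]
    have := summable_geometric_two.sum_le_tsum F fun i _ => by positivity
    rw [tsum_geometric_two] at this
    linarith
  rw [Finset.sum_add_distrib] at h1
  linarith

/-- The peak functions are controlled only on the Choquet boundary. The scalar sum lies in `A`, so
the bound `2` found there holds on all of `K₁`. -/
theorem norm_sum_smul_tensor_le {f : ℕ → scalarMultipliers H₁} {V : ℕ → Set K₁}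
    (hV : Pairwise (Function.onFun Disjoint V))
    (hf : ∀ n y, 0 ≤ (f n : C(K₁, ℝ)) y ∧ (f n : C(K₁, ℝ)) y ≤ 1)
    (hfV : ∀ n, ∀ y ∈ choquetBoundary H₁ \ V n, (f n : C(K₁, ℝ)) y < (1 / 2) ^ n / 2)
    (e : E₁) (F : Finset ℕ) (c : ℕ → ℝ) (hc : ∀ i, |c i| ≤ 1) :
    ‖∑ i ∈ F, c i • multiplierTensor (f i) e‖ ≤ 2 * ‖e‖ := by
  have hmem : ∑ i ∈ F, c i • (f i : C(K₁, ℝ)) ∈ scalarSpace H₁ :=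
    Submodule.sum_mem _ fun i _ => Submodule.smul_mem _ _ (f i).2.1
  have hbound : ∀ y, |(∑ i ∈ F, c i • (f i : C(K₁, ℝ))) y| ≤ 2 := by
    refine abs_apply_le_of_forall_evalOn_mem_extremePoints _ hmem fun y hy => ?_
    refine le_trans ?_ (sum_le_two_of_pairwise_disjoint (t := fun i => (f i : C(K₁, ℝ)) y) hV
      (fun i => (hf i y).2) (fun i hi => (hfV i y ⟨hy, hi⟩).le) F)
    rw [ContinuousMap.sum_apply]
    refine (Finset.abs_sum_le_sum_abs _ _).trans (Finset.sum_le_sum fun i _ => ?_)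
    rw [ContinuousMap.smul_apply, smul_eq_mul, abs_mul, abs_of_nonneg (hf i y).1]
    exact mul_le_of_le_one_left (hf i y).1 (hc i)
  refine (ContinuousMap.norm_le _ (by positivity)).2 fun y => ?_
  have h : ((∑ i ∈ F, c i • multiplierTensor (f i) e : H₁) : C(K₁, E₁)) y =
      (∑ i ∈ F, c i • (f i : C(K₁, ℝ))) y • e := by
    rw [Submodule.coe_sum, ContinuousMap.sum_apply, ContinuousMap.sum_apply, Finset.sum_smul]
    refine Finset.sum_congr rfl fun i _ => ?_
    simp [coe_multiplierTensor_apply, mul_smul]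
  change ‖((∑ i ∈ F, c i • multiplierTensor (f i) e : H₁) : C(K₁, E₁)) y‖ ≤ 2 * ‖e‖
  rw [h, norm_smul]
  exact mul_le_mul_of_nonneg_right (hbound y) (norm_nonneg e)

/-! ### Counting large images and the inductive construction -/

variable {K₂ : Type*} [TopologicalSpace K₂]
  {E₂ : Type*} [NormedAddCommGroup E₂] [NormedSpace ℝ E₂]

open Classical in
/-- The number of members `f` of a list with `‖R (f ⊗ e) y‖ ≥ ε`. -/
noncomputable def largeCount (R : H₁ →ₗ[ℝ] C(K₂, E₂)) (e : E₁) (ε : ℝ)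
    (l : List (scalarMultipliers H₁)) (y : K₂) : ℕ :=
  l.countP fun f => ε ≤ ‖R (multiplierTensor f e) y‖

theorem largeCount_nil (R : H₁ →ₗ[ℝ] C(K₂, E₂)) (e : E₁) (ε : ℝ) (y : K₂) :
    largeCount R e ε [] y = 0 := rfl

theorem largeCount_cons_of_le {R : H₁ →ₗ[ℝ] C(K₂, E₂)} {e : E₁} {ε : ℝ}
    {f : scalarMultipliers H₁} (l : List (scalarMultipliers H₁)) {y : K₂}
    (h : ε ≤ ‖R (multiplierTensor f e) y‖) :
    largeCount R e ε (f :: l) y = largeCount R e ε l y + 1 := by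
  simp [largeCount, h]

theorem largeCount_cons_of_lt {R : H₁ →ₗ[ℝ] C(K₂, E₂)} {e : E₁} {ε : ℝ}
    {f : scalarMultipliers H₁} (l : List (scalarMultipliers H₁)) {y : K₂}
    (h : ‖R (multiplierTensor f e) y‖ < ε) :
    largeCount R e ε (f :: l) y = largeCount R e ε l y := by
  simp [largeCount, h]

/-- Upper semicontinuity of the count: the condition `‖R (f ⊗ e) y‖ < ε` is open in `y`. -/
theorem eventually_largeCount_le (R : H₁ →ₗ[ℝ] C(K₂, E₂)) (e : E₁) (ε : ℝ)
    (l : List (scalarMultipliers H₁)) (z : K₂) :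
    ∀ᶠ y in 𝓝 z, largeCount R e ε l y ≤ largeCount R e ε l z := by
  induction l with
  | nil => exact Eventually.of_forall fun y => le_rfl
  | cons f l ih =>
    rcases le_or_gt ε ‖R (multiplierTensor f e) z‖ with h | h
    · rw [largeCount_cons_of_le l h]
      filter_upwards [ih] with y hy
      rcases le_or_gt ε ‖R (multiplierTensor f e) y‖ with h' | h'
      · rw [largeCount_cons_of_le l h']
        omega
      · rw [largeCount_cons_of_lt l h']
        omega
    · rw [largeCount_cons_of_lt l h]
      filter_upwards [ih, (R (multiplierTensor f e)).continuous.norm.continuousAt.eventually_lt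
        continuousAt_const h] with y hy h'
      rwa [largeCount_cons_of_lt l h']

variable [CompactSpace K₂]

theorem exists_multiplier_norm_lt [T2Space K₁] [CompleteSpace E₂] (hE₂ : ¬ ContainsCZero E₂)
    {R : H₁ →ₗ[ℝ] C(K₂, E₂)} {C : ℝ} (hC : 0 ≤ C) (hR : ∀ h, ‖R h‖ ≤ C * ‖h‖) {S U : Set K₁}
    {x : K₁} (hS : S ⊆ weakPeakPoints H₁) (hx : AccPt x (𝓟 S)) (hU : U ∈ 𝓝 x) (e : E₁) {F : Set K₂}
    (hF : F.Finite) {ε : ℝ} (hε : 0 < ε) (hε1 : ε < 1) :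
    ∃ x' ∈ S ∩ U, ∃ f : scalarMultipliers H₁,
      (∀ y, 0 ≤ (f : C(K₁, ℝ)) y ∧ (f : C(K₁, ℝ)) y ≤ 1) ∧ 1 - ε < (f : C(K₁, ℝ)) x' ∧
        ∀ y ∈ F, ‖R (multiplierTensor f e) y‖ < ε := by
  obtain ⟨p, V, hp, hpV, hV⟩ := hx.exists_seq_pairwise_disjoint_nhds hU
  have hhalf : ∀ n : ℕ, ((1 : ℝ) / 2) ^ n ≤ 1 := fun n => pow_le_one₀ (by norm_num) (by norm_num)
  -- The tolerance `ε 2⁻ⁿ / 2` is at most `ε`, for peaking, and at most `2⁻ⁿ / 2`, for the bound on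
  -- signed sums.
  have hεn : ∀ n : ℕ, 0 < ε * ((1 / 2) ^ n / 2) ∧ ε * ((1 / 2) ^ n / 2) ≤ ε ∧
      ε * ((1 / 2) ^ n / 2) ≤ (1 / 2) ^ n / 2 := fun n =>
    ⟨by positivity, mul_le_of_le_one_right hε.le (by linarith [hhalf n]),
      mul_le_of_le_one_left (by positivity) hε1.le⟩
  choose f hfm hf hfp hfV using fun n => hS (hp n).1 (V n) (hpV n) (ε * ((1 / 2) ^ n / 2))
    (hεn n).1 ((hεn n).2.1.trans_lt hε1)
  let g : ℕ → scalarMultipliers H₁ := fun n => ⟨f n, hfm n⟩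
  have hbd : ∀ y, UnconditionallyBounded (fun n => R (multiplierTensor (g n) e) y) (C * (2 * ‖e‖)) := by
    intro y G c hc
    have h : ∑ i ∈ G, c i • R (multiplierTensor (g i) e) y = R (∑ i ∈ G, c i • multiplierTensor (g i) e) y := by
      simp [map_sum]
    rw [h]
    refine (ContinuousMap.norm_coe_le_norm _ y).trans ((hR _).trans ?_)
    exact mul_le_mul_of_nonneg_left (norm_sum_smul_tensor_le hV hf
      (fun n y hy => (hfV n y hy).trans_le (hεn n).2.2) e G c hc) hC
  obtain ⟨n, hn⟩ := (hF.biUnion fun y _ => (hbd y).finite_setOf_le_norm hE₂ hε).exists_notMem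
  refine ⟨p n, hp n, g n, hf n, ?_, fun y hy => ?_⟩
  · exact lt_of_le_of_lt (by linarith [(hεn n).2.1]) (hfp n)
  · by_contra h
    exact hn (mem_biUnion hy (not_lt.1 h))

theorem norm_map_sum_tensor_le {R : H₁ →ₗ[ℝ] C(K₂, E₂)} {e : E₁} {ε C : ℝ}
    (hε : 0 ≤ ε) {l : List (scalarMultipliers H₁)} (hl : ∀ f ∈ l, ‖R (multiplierTensor f e)‖ ≤ C) (y : K₂) :
    ‖R (l.map fun f => multiplierTensor f e).sum y‖ ≤ largeCount R e ε l y * C + l.length * ε := by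
  induction l with
  | nil => simp [largeCount_nil]
  | cons f l ih =>
    have ih := ih fun g hg => hl g (List.mem_cons_of_mem f hg)
    have hf := ((R (multiplierTensor f e)).norm_coe_le_norm y).trans (hl f List.mem_cons_self)
    rw [List.map_cons, List.sum_cons, map_add, ContinuousMap.add_apply, List.length_cons]
    refine (norm_add_le _ _).trans ?_
    push_cast
    rcases le_or_gt ε ‖R (multiplierTensor f e) y‖ with h | h
    · rw [largeCount_cons_of_le l h]
      push_cast
      linarith
    · rw [largeCount_cons_of_lt l h]
      linarith

/-- Induction on the length `i`, trading one derivative of the weak peak set (`j + 1` to `j`) for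
one new multiplier. The common point moves slightly, keeping the old strict inequalities. -/
theorem exists_list_multipliers [T2Space K₁] [T1Space K₂] [CompleteSpace E₂]
    (hE₂ : ¬ ContainsCZero E₂) {R : H₁ →ₗ[ℝ] C(K₂, E₂)} {C : ℝ} (hC : 0 ≤ C)
    (hR : ∀ h, ‖R h‖ ≤ C * ‖h‖) {B : Set K₂} (hB : IsClosed B) {k : ℕ}
    (hk : ∀ y ∈ cbDerivative B k, ∀ h, R h y = 0) (e : E₁) {ε : ℝ} (hε : 0 < ε) (hε1 : ε < 1)
    (i j : ℕ) (hne : (cbDerivative (weakPeakPoints H₁) ((i + j : ℕ) : Ordinal.{u})).Nonempty) :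
    ∃ x ∈ cbDerivative (weakPeakPoints H₁) (j : Ordinal.{u}), ∃ l : List (scalarMultipliers H₁),
      l.length = i ∧
      (∀ f ∈ l, (∀ y, 0 ≤ (f : C(K₁, ℝ)) y ∧ (f : C(K₁, ℝ)) y ≤ 1) ∧
        1 - ε < (f : C(K₁, ℝ)) x) ∧
      ∀ r ≤ k, ∀ y ∈ cbDerivative B r, largeCount R e ε l y + r ≤ k := by
  induction i generalizing j with
  | zero =>
    rw [zero_add] at hne
    obtain ⟨x, hx⟩ := hne
    exact ⟨x, hx, [], rfl, by simp, fun r hr y _ => by simpa [largeCount_nil] using hr⟩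
  | succ i ih =>
    obtain ⟨x, hx, l, hl, hlx, hcount⟩ := ih (j + 1) (by rwa [show i + (j + 1) = i + 1 + j by omega])
    rw [cbDerivative_natCast_succ] at hx
    have hU : {x' | ∀ f ∈ l, 1 - ε < (f : C(K₁, ℝ)) x'} ∈ 𝓝 x := by
      have : ∀ l' : List (scalarMultipliers H₁), (∀ f ∈ l', 1 - ε < (f : C(K₁, ℝ)) x) →
          ∀ᶠ x' in 𝓝 x, ∀ f ∈ l', 1 - ε < (f : C(K₁, ℝ)) x' := by
        intro l'
        induction l' with
        | nil => simp
        | cons f l' ih' =>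
          intro h
          filter_upwards [ih' fun g hg => h g (List.mem_cons_of_mem f hg),
            continuousAt_const.eventually_lt (f : C(K₁, ℝ)).continuous.continuousAt
              (h f List.mem_cons_self)] with x' h1 h2
          exact List.forall_mem_cons.2 ⟨h2, h1⟩
      exact this l fun f hf => (hlx f hf).2
    -- The saturated points, where one more large image would break the invariant. Level `r = k` is
    -- left out, since `R h` vanishes there.
    have hF : (⋃ r ∈ Iio k, {y | y ∈ cbDerivative B r ∧ k ≤ largeCount R e ε l y + r}).Finite :=
      (finite_Iio k).biUnion fun r hr => finite_setOf_mem_cbDerivative_le hB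
        (eventually_largeCount_le R e ε l) (hcount (r + 1) hr)
    obtain ⟨x', ⟨hx', hx'U⟩, f, hf, hfx', hfF⟩ := exists_multiplier_norm_lt hE₂ hC hR
      (cbDerivative_natCast_subset _ j) hx.2 hU e hF hε hε1
    refine ⟨x', hx', f :: l, by simp [hl], ?_, fun r hr y hy => ?_⟩
    · exact List.forall_mem_cons.2 ⟨⟨hf, hfx'⟩, fun g hg => ⟨(hlx g hg).1, hx'U g hg⟩⟩
    have hry := hcount r hr y hy
    rcases le_or_gt ε ‖R (multiplierTensor f e) y‖ with h | h
    · rw [largeCount_cons_of_le l h]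
      by_contra hlt
      rcases hr.lt_or_eq with hr' | rfl
      · exact (hfF y (mem_biUnion (show r ∈ Iio k from hr') ⟨hy, by omega⟩)).not_ge h
      · rw [hk y hy, norm_zero] at h
        exact h.not_gt hε
    · rwa [largeCount_cons_of_lt l h]

/-- If `E₁` were trivial, `A` would be zero and could contain no function exceeding `1 / 2` at `x`.
-/
theorem exists_ne_zero_of_mem_weakPeakPoints {x : K₁} (hx : x ∈ weakPeakPoints H₁) :
    ∃ e : E₁, e ≠ 0 := by
  by_contra! h
  obtain ⟨f, hf, -, hfx, -⟩ := hx univ univ_mem (1 / 2) (by norm_num) (by norm_num)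
  have hzero : {f | ∃ φ : StrongDual ℝ E₁, ∃ h ∈ H₁, f = dualComp φ h} ⊆ {0} := by
    rintro _ ⟨φ, g, -, rfl⟩
    ext y
    simp [dualComp, h]
  have hf0 := closure_mono (Submodule.span_mono (R := ℝ) hzero) hf.1
  rw [Submodule.span_zero_singleton, Submodule.bot_coe, closure_singleton] at hf0
  rw [mem_singleton_iff.1 hf0] at hfx
  norm_num at hfx

theorem exists_cbDerivative_weakPeakPoints_eq_empty [T2Space K₁] [T1Space K₂] [CompleteSpace E₂]
    (hE₂ : ¬ ContainsCZero E₂) {R : H₁ →ₗ[ℝ] C(K₂, E₂)} {C c : ℝ} (hC : 0 ≤ C) (hc : 0 ≤ c)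
    (hR : ∀ h, ‖R h‖ ≤ C * ‖h‖) (hR' : ∀ h, ‖h‖ ≤ c * ‖R h‖) {B : Set K₂} (hB : IsClosed B)
    (hRB : ∀ h, ‖R h‖ = ⨆ x : B, ‖R h x‖) {k : ℕ}
    (hk : ∀ y ∈ cbDerivative B k, ∀ h, R h y = 0) :
    ∃ n : ℕ, cbDerivative (weakPeakPoints H₁) (n : Ordinal.{u}) = ∅ := by
  by_contra! hne
  obtain ⟨x₀, hx₀⟩ := hne 0
  obtain ⟨e₀, he₀⟩ := exists_ne_zero_of_mem_weakPeakPoints (cbDerivative_natCast_subset _ 0 hx₀)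
  obtain ⟨e, he⟩ : ∃ e : E₁, ‖e‖ = 1 := ⟨‖e₀‖⁻¹ • e₀, norm_smul_inv_norm (𝕜 := ℝ) he₀⟩
  -- These choices refute `m(1 - ε) ≤ c(kC + mε)`: since `ε + cε ≤ 1 / 2`, it would force `m ≤
  -- 2ckC`.
  obtain ⟨m, hm⟩ := exists_nat_gt (2 * (c * (k * C)))
  obtain ⟨ε, hε, hε1, hcε⟩ : ∃ ε : ℝ, 0 < ε ∧ ε < 1 ∧ ε + c * ε ≤ 1 / 2 := by
    refine ⟨1 / (2 * (1 + c)), by positivity, ?_, ?_⟩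
    · rw [div_lt_one (by positivity)]
      linarith
    · rw [← one_add_mul, mul_one_div, div_le_div_iff₀ (by positivity) two_pos]
      linarith
  obtain ⟨x, -, l, hl, hlx, hcount⟩ := exists_list_multipliers hE₂ hC hR hB hk e hε hε1 m 0
    (by simpa using hne m)
  set h : H₁ := (l.map fun f => multiplierTensor f e).sum with hh
  have hlow : m * (1 - ε) ≤ ‖h‖ := by
    have hx : (h : C(K₁, E₁)) x = (l.map fun f : scalarMultipliers H₁ => (f : C(K₁, ℝ)) x).sum • e := by
      rw [hh]
      clear hcount hlx hl hh h
      induction l with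
      | nil => simp
      | cons f l ih =>
        rw [List.map_cons, List.map_cons, List.sum_cons, List.sum_cons, Submodule.coe_add,
          ContinuousMap.add_apply, ih, coe_multiplierTensor_apply, add_smul]
    have hsum : m * (1 - ε) ≤ (l.map fun f : scalarMultipliers H₁ => (f : C(K₁, ℝ)) x).sum := by
      rw [← hl]
      have := List.card_nsmul_le_sum (l.map fun f : scalarMultipliers H₁ => (f : C(K₁, ℝ)) x) (1 - ε) fun t ht => by
        obtain ⟨f, hf, rfl⟩ := List.mem_map.1 ht
        exact (hlx f hf).2.le
      simpa using this
    calc m * (1 - ε) ≤ ‖(h : C(K₁, E₁)) x‖ := by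
          rw [hx, norm_smul, he, mul_one]
          exact hsum.trans (le_abs_self _)
      _ ≤ ‖h‖ := (h : C(K₁, E₁)).norm_coe_le_norm x
  have hup : ‖R h‖ ≤ k * C + m * ε := by
    rw [hRB]
    refine Real.iSup_le (fun y => ?_) (by positivity)
    have h1 := norm_map_sum_tensor_le (ε := ε) hε.le (fun f hf => by
      refine (hR _).trans (mul_le_of_le_one_right hC ?_)
      exact (norm_multiplierTensor_le (hlx f hf).1 e).trans he.le) (y : K₂)
    rw [hl] at h1
    -- The invariant at `r = 0` bounds the count by `k` on all of `B`.
    refine h1.trans (add_le_add_left (mul_le_mul_of_nonneg_right ?_ hC) _)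
    have := hcount 0 (Nat.zero_le k) y (by rw [Nat.cast_zero, cbDerivative_zero]; exact y.2)
    exact_mod_cast this
  have h2 := (hlow.trans (hR' h)).trans (mul_le_mul_of_nonneg_left hup hc)
  have h3 : (m : ℝ) * (ε + c * ε) ≤ m * (1 / 2) := mul_le_mul_of_nonneg_left hcε (Nat.cast_nonneg m)
  linarith

end Multipliers

/-! ### The theorem -/

theorem corollary1p4
    {K₁ K₂ E₁ E₂ : Type*}
    [TopologicalSpace K₁] [CompactSpace K₁] [T2Space K₁]
    [TopologicalSpace K₂] [CompactSpace K₂] [T2Space K₂]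
    [NormedAddCommGroup E₁] [NormedSpace ℝ E₁] [CompleteSpace E₁]
    [NormedAddCommGroup E₂] [NormedSpace ℝ E₂] [CompleteSpace E₂]
    (H₁ : Submodule ℝ C(K₁, E₁)) (hH₁ : IsClosed (H₁ : Set C(K₁, E₁)))
    (H₂ : Submodule ℝ C(K₂, E₂)) (hH₂ : IsClosed (H₂ : Set C(K₂, E₂)))
    (hE₂ : ¬ ContainsCZero E₂)
    (B : Set K₂) (hBclosed : IsClosed B) (hB : IsBoundary H₂ B)
    (hemb : EmbedsIsomorphically H₁ H₂)
    (hk : ∃ k : ℕ, cbDerivative B k ∩ nonvanishingSet H₂ = ∅) :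
    HasFiniteHeight (weakPeakPoints H₁) := by
  obtain ⟨M, ⟨Φ⟩⟩ := hemb
  obtain ⟨k, hk⟩ := hk
  let R : H₁ →ₗ[ℝ] C(K₂, E₂) := H₂.subtype ∘ₗ M.subtype ∘ₗ Φ.toLinearEquiv.toLinearMap
  have hRH : ∀ h, R h ∈ H₂ := fun h => (Φ h : H₂).2
  obtain ⟨n, hn⟩ := exists_cbDerivative_weakPeakPoints_eq_empty (R := R) hE₂
    (norm_nonneg (Φ : H₁ →L[ℝ] M)) (norm_nonneg (Φ.symm : M →L[ℝ] H₁))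
    (fun h => (Φ : H₁ →L[ℝ] M).le_opNorm h)
    (fun h => by
      have := (Φ.symm : M →L[ℝ] H₁).le_opNorm (Φ h)
      rwa [ContinuousLinearEquiv.coe_coe, Φ.symm_apply_apply] at this)
    hBclosed (fun h => hB _ (hRH h)) (k := k)
    (fun y hy h => by
      by_contra hne
      exact (hk.le ⟨hy, R h, hRH h, hne⟩ : y ∈ (∅ : Set K₂)))
  exact hasFiniteHeight_of_cbDerivative_natCast_eq_empty hn
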